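/- Let $k \ge 1$. A *$\Sigma^0_k$ Boolean algebra* is a Boolean algebra $\mathcal B$ represented by a structure $(\omega, \preceq, \vee, \wedge, {}')$ such that $\preceq$ is a $\Sigma^0_k$ preorder on $\omega$, the functions $\vee, \wedge : \omega^2 \to \omega$ and ${}' : \omega \to \omega$ are computable and compatible with the equivalence relation $\approx$ given by $x \approx y \Leftrightarrow x \preceq y \wedge y \preceq x$, and the quotient $(\omega, \preceq, \vee, \wedge, {}')/_{\approx}$ is isomorphic to $\mathcal B$; we write $\preceq_{\mathcal B}$ for $\preceq$. A number is a *name* of the element of $\mathcal B$ that its $\approx$-class is mapped to under the isomorphism. Let $W_e^{X}$ denote the $e$-th set that is r.e. in $X$, and $\emptyset^{(n)}$ the $n$-th Turing jump of $\emptyset$. Disjoint $\Sigma^0_k$ sets $A, B \subseteq \omega$ are *effectively inseparable* if there is a computable (without oracle) total binary function $g$ such that for all $p, q \in \omega$: if $A \subseteq W_p^{\emptyset^{(k-1)}}$, $B \subseteq W_q^{\emptyset^{(k-1)}}$ and $W_p^{\emptyset^{(k-1)}} \cap W_q^{\emptyset^{(k-1)}} = \emptyset$, then $g(p,q) \notin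 W_p^{\emptyset^{(k-1)}} \cup W_q^{\emptyset^{(k-1)}}$. A $\Sigma^0_k$ Boolean algebra $\mathcal B$ is *$\Sigma^0_k$-effectively inseparable* if the set of names of $0 \in \mathcal B$ and the set of names of $1 \in \mathcal B$ are disjoint and effectively inseparable. **Theorem.** If a $\Sigma^0_k$ Boolean algebra $\mathcal B$ is $\Sigma^0_k$-effectively inseparable, then $\preceq_{\mathcal B}$ is a $\Sigma^0_k$-complete preorder: it is a $\Sigma^0_k$ preorder, and for every $\Sigma^0_k$ preorder $P$ on $\omega$ there is a computable function $f : \omega \to \omega$ such that for all $x, y \in \omega$, $\langle x, y\rangle \in P \Leftrightarrow f(x) \preceq_{\mathcal B} f(y)$. -/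

import Mathlib

namespace SigmaBA

/-! ### Oracle programs and relativized r.e. sets -/

/-- Programs for partial functions on the natural numbers with access to an oracle: one
constructor for each clause of Mathlib's `Nat.RecursiveIn`. -/
inductive OracleCode : Type
  | zero : OracleCode
  | succ : OracleCode
  | left : OracleCode
  | right : OracleCode
  | oracle : OracleCode
  | pair : OracleCode → OracleCode → OracleCode
  | comp : OracleCode → OracleCode → OracleCode
  | prec : OracleCode → OracleCode → OracleCode
  | rfind : OracleCode → OracleCode

open Classical in
/-- The characteristic function of a set of natural numbers. -/
noncomputable def charFn (A : Set ℕ) : ℕ →. ℕ :=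
  fun n => Part.some (if n ∈ A then 1 else 0)

/-- The partial function computed by an oracle program with oracle `A`. -/
noncomputable def OracleCode.eval (A : Set ℕ) : OracleCode → ℕ →. ℕ
  | .zero => fun _ => Part.some 0
  | .succ => fun n => Part.some (n + 1)
  | .left => fun n => Part.some n.unpair.1
  | .right => fun n => Part.some n.unpair.2
  | .oracle => charFn A
  | .pair c d => fun n => Nat.pair <$> c.eval A n <*> d.eval A n
  | .comp c d => fun n => d.eval A n >>= c.eval A
  | .prec c d => fun p =>
      Nat.rec (c.eval A p.unpair.1)
        (fun y IH => IH >>= fun i => d.eval A (Nat.pair p.unpair.1 (Nat.pair y i)))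
        p.unpair.2
  | .rfind c => fun a =>
      Nat.rfind fun n => (fun m => decide (m = 0)) <$> c.eval A (Nat.pair a n)

/-- The effective numbering of oracle programs: the program with index `e`. -/
def OracleCode.ofNat : ℕ → OracleCode
  | 0 => .zero
  | 1 => .succ
  | 2 => .left
  | 3 => .right
  | 4 => .oracle
  | n + 5 =>
    have h₁ : (n / 4).unpair.1 < n + 5 :=
      lt_of_le_of_lt ((Nat.unpair_left_le _).trans (Nat.div_le_self n 4)) (by omega)
    have h₂ : (n / 4).unpair.2 < n + 5 :=
      lt_of_le_of_lt ((Nat.unpair_right_le _).trans (Nat.div_le_self n 4)) (by omega)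
    have h₃ : n / 4 < n + 5 := by omega
    match n % 4 with
    | 0 => .pair (ofNat (n / 4).unpair.1) (ofNat (n / 4).unpair.2)
    | 1 => .comp (ofNat (n / 4).unpair.1) (ofNat (n / 4).unpair.2)
    | 2 => .prec (ofNat (n / 4).unpair.1) (ofNat (n / 4).unpair.2)
    | _ => .rfind (ofNat (n / 4))

/-- `W e A` is the `e`-th set that is r.e. in `A`: the domain of the `e`-th partial function
that is computable with oracle `A`. -/
def W (e : ℕ) (A : Set ℕ) : Set ℕ :=
  {x | ((OracleCode.ofNat e).eval A x).Dom}

/-- The Turing jump of `A`. -/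
def jump (A : Set ℕ) : Set ℕ := {e | e ∈ W e A}

/-- `emptyJump n` is the `n`-th Turing jump of the empty set. -/
def emptyJump : ℕ → Set ℕ
  | 0 => ∅
  | n + 1 => jump (emptyJump n)

/-! ### The arithmetical hierarchy -/

/-- The set `X` is `Σ⁰_k`. Here `Σ⁰_0` means computable, and `X` is `Σ⁰_{k+1}` if
`x ∈ X ↔ ∃ n, ⟨x, n⟩ ∉ Y` for some `Σ⁰_k` set `Y`. -/
def IsSigma : ℕ → Set ℕ → Prop
  | 0, X => ComputablePred fun x => x ∈ X
  | k + 1, X => ∃ Y : Set ℕ, IsSigma k Y ∧ ∀ x, x ∈ X ↔ ∃ n, Nat.pair x n ∉ Y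

/-- A binary relation on `ℕ` is `Σ⁰_k` if the set of codes of its pairs is. -/
def IsSigmaRel (k : ℕ) (R : ℕ → ℕ → Prop) : Prop :=
  IsSigma k {n | R n.unpair.1 n.unpair.2}

/-- `R` is a `Σ⁰_k` preorder on `ℕ`. -/
def IsSigmaPreorder (k : ℕ) (R : ℕ → ℕ → Prop) : Prop :=
  (∀ x, R x x) ∧ (∀ x y z, R x y → R y z → R x z) ∧ IsSigmaRel k R

/-- `P ≤_c R`: componentwise computable reducibility of binary relations on `ℕ`. -/
def ComputablyReducible (P R : ℕ → ℕ → Prop) : Prop :=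
  ∃ f : ℕ → ℕ, Computable f ∧ ∀ x y, P x y ↔ R (f x) (f y)

/-- `R` is a `Σ⁰_k`-complete preorder: it is a `Σ⁰_k` preorder, and every `Σ⁰_k` preorder is
computably reducible to it. -/
def IsSigmaCompletePreorder (k : ℕ) (R : ℕ → ℕ → Prop) : Prop :=
  IsSigmaPreorder k R ∧ ∀ P : ℕ → ℕ → Prop, IsSigmaPreorder k P → ComputablyReducible P R

/-! ### Effective inseparability -/

/-- The disjoint `Σ⁰_k` sets `A`, `B` are effectively inseparable (for `k ≥ 1`). The productive
function `g` is computable without an oracle. -/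
def EffectivelyInseparable (k : ℕ) (A B : Set ℕ) : Prop :=
  IsSigma k A ∧ IsSigma k B ∧ Disjoint A B ∧
    ∃ g : ℕ → ℕ → ℕ, Computable₂ g ∧ ∀ p q : ℕ,
      A ⊆ W p (emptyJump (k - 1)) → B ⊆ W q (emptyJump (k - 1)) →
      Disjoint (W p (emptyJump (k - 1))) (W q (emptyJump (k - 1))) →
      g p q ∉ W p (emptyJump (k - 1)) ∪ W q (emptyJump (k - 1))

/-! ### `Σ⁰_k` Boolean algebras -/

/-- A presentation of the Boolean algebra `B` as a `Σ⁰_k` Boolean algebra: a structure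
`(ℕ, le, sup, inf, compl)` where `le` is a `Σ⁰_k` preorder and the operations are computable,
together with a map `val : ℕ → B`, taking each name to the element that it denotes, which
induces an isomorphism of the quotient of the structure (by the equivalence relation of `le`)
with `B`. -/
structure Presentation (k : ℕ) (B : Type*) [BooleanAlgebra B] where
  le : ℕ → ℕ → Prop
  sup : ℕ → ℕ → ℕ
  inf : ℕ → ℕ → ℕ
  compl : ℕ → ℕ
  sigma_le : IsSigmaPreorder k le
  computable_sup : Computable₂ sup
  computable_inf : Computable₂ inf
  computable_compl : Computable compl
  val : ℕ → B
  val_surjective : Function.Surjective val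
  le_iff : ∀ x y, le x y ↔ val x ≤ val y
  val_sup : ∀ x y, val (sup x y) = val x ⊔ val y
  val_inf : ∀ x y, val (inf x y) = val x ⊓ val y
  val_compl : ∀ x, val (compl x) = (val x)ᶜ

/-- A presented `Σ⁰_k` Boolean algebra is effectively inseparable if the set of names of `0`
and the set of names of `1` are. -/
def Presentation.IsEffectivelyInseparable {k : ℕ} {B : Type*} [BooleanAlgebra B]
    (𝓑 : Presentation k B) : Prop :=
  EffectivelyInseparable k {x | 𝓑.val x = ⊥} {x | 𝓑.val x = ⊤}

end SigmaBA

/-!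
Let `P` be a `Σ⁰_k` preorder. In the Boolean algebra generated by `x₀, x₁, …` subject to the relations
`xᵢ ≤ xₗ` for `P i l`, one has `xᵢ ≤ xₗ` exactly if `P i l`, because the `P`-up-sets are two-valued
homomorphisms. The reduction embeds this algebra computably into `𝓑`, one generator at a time.

Suppose the generators of index below `n` have been placed so that a minterm in them is `⊥` exactly
if its sign pattern is inconsistent with `P` (`val_minterm_eq_bot_iff`). The trace of the next
generator on a nonzero minterm has to be `⊥`, everything, or strictly between, according to two
disjoint `Σ⁰_k` events: whether `P` puts the new index below a negative one, or a positive one below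
the new index. `Presentation.exists_separating` computes such a trace. Its point is that the
productive function for the names of `⊥` and `⊤` works unchanged below every nonzero `b`, since
`{x | x ⊓ b = ⊥}` and `{x | b ≤ x}` are disjoint supersets of these two sets. Once all minterms behave
correctly, `generator_le_iff` compares two generators minterm by minterm.

On the computability side, `IsSigma.reIn` turns `Σ⁰_k` sets into sets that are r.e. in the jump
`emptyJump (k - 1)`, and `curryIndex` is the `s`-`m`-`n` function that provides self-reference with
indices computable without an oracle.
-/

namespace SigmaBA

/-! ### Total functions computable in an oracle -/

/-- The total function `f` is computable with oracle `A`. -/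
def RecIn (A : Set ℕ) (f : ℕ → ℕ) : Prop :=
  ∃ c : OracleCode, ∀ n, c.eval A n = Part.some (f n)

theorem exists_code_of_partrec (A : Set ℕ) {f : ℕ →. ℕ} (hf : Nat.Partrec f) :
    ∃ c : OracleCode, c.eval A = f := by
  induction hf with
  | zero => exact ⟨.zero, rfl⟩
  | succ => exact ⟨.succ, rfl⟩
  | left => exact ⟨.left, rfl⟩
  | right => exact ⟨.right, rfl⟩
  | pair _ _ ihf ihg =>
    obtain ⟨c, rfl⟩ := ihf
    obtain ⟨d, rfl⟩ := ihg
    exact ⟨.pair c d, rfl⟩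
  | comp _ _ ihf ihg =>
    obtain ⟨c, rfl⟩ := ihf
    obtain ⟨d, rfl⟩ := ihg
    exact ⟨.comp c d, rfl⟩
  | prec _ _ ihf ihg =>
    obtain ⟨c, rfl⟩ := ihf
    obtain ⟨d, rfl⟩ := ihg
    exact ⟨.prec c d, rfl⟩
  | rfind _ ihf =>
    obtain ⟨c, rfl⟩ := ihf
    exact ⟨.rfind c, rfl⟩

theorem RecIn.of_computable {A : Set ℕ} {f : ℕ → ℕ} (hf : Computable f) : RecIn A f := by
  obtain ⟨c, hc⟩ := exists_code_of_partrec A (Partrec.nat_iff.1 hf)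
  exact ⟨c, fun n => by rw [hc]; rfl⟩

theorem OracleCode.eval_comp_of_eq_some {A : Set ℕ} {c d : OracleCode} {n m : ℕ}
    (h : d.eval A n = Part.some m) : (OracleCode.comp c d).eval A n = c.eval A m := by
  change (d.eval A n).bind (fun i => c.eval A i) = _
  rw [h]
  exact Part.bind_some _ _

theorem RecIn.comp {A : Set ℕ} {f g : ℕ → ℕ} (hf : RecIn A f) (hg : RecIn A g) :
    RecIn A fun n => f (g n) := by
  obtain ⟨c, hc⟩ := hf
  obtain ⟨d, hd⟩ := hg
  exact ⟨.comp c d, fun n => (OracleCode.eval_comp_of_eq_some (hd n)).trans (hc _)⟩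

theorem RecIn.pair {A : Set ℕ} {f g : ℕ → ℕ} (hf : RecIn A f) (hg : RecIn A g) :
    RecIn A fun n => Nat.pair (f n) (g n) := by
  obtain ⟨c, hc⟩ := hf
  obtain ⟨d, hd⟩ := hg
  exact ⟨.pair c d, fun n => by simp [OracleCode.eval, hc, hd, Seq.seq]⟩

theorem RecIn.comp₂ {A : Set ℕ} {F : ℕ → ℕ → ℕ} {f g : ℕ → ℕ} (hF : Computable₂ F)
    (hf : RecIn A f) (hg : RecIn A g) : RecIn A fun n => F (f n) (g n) := by
  have h : Computable fun n : ℕ => F n.unpair.1 n.unpair.2 :=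
    hF.comp (Computable.fst.comp Computable.unpair) (Computable.snd.comp Computable.unpair)
  simpa using (RecIn.of_computable (A := A) h).comp (hf.pair hg)

/-! ### Indices of oracle programs -/

theorem OracleCode.ofNat_pair (a b : ℕ) :
    ofNat (4 * Nat.pair a b + 5) = .pair (ofNat a) (ofNat b) := by
  have h₁ : 4 * Nat.pair a b / 4 = Nat.pair a b := by omega
  have h₂ : 4 * Nat.pair a b % 4 = 0 := by omega
  rw [ofNat]
  simp [h₁, h₂]

theorem OracleCode.ofNat_comp (a b : ℕ) :
    ofNat (4 * Nat.pair a b + 6) = .comp (ofNat a) (ofNat b) := by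
  have h₁ : (4 * Nat.pair a b + 1) / 4 = Nat.pair a b := by omega
  have h₂ : (4 * Nat.pair a b + 1) % 4 = 1 := by omega
  rw [show 4 * Nat.pair a b + 6 = (4 * Nat.pair a b + 1) + 5 from rfl, ofNat]
  simp [h₁, h₂]

theorem OracleCode.ofNat_prec (a b : ℕ) :
    ofNat (4 * Nat.pair a b + 7) = .prec (ofNat a) (ofNat b) := by
  have h₁ : (4 * Nat.pair a b + 2) / 4 = Nat.pair a b := by omega
  have h₂ : (4 * Nat.pair a b + 2) % 4 = 2 := by omega
  rw [show 4 * Nat.pair a b + 7 = (4 * Nat.pair a b + 2) + 5 from rfl, ofNat]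
  simp [h₁, h₂]

theorem OracleCode.ofNat_rfind (a : ℕ) : ofNat (4 * a + 8) = .rfind (ofNat a) := by
  have h₁ : (4 * a + 3) / 4 = a := by omega
  have h₂ : (4 * a + 3) % 4 = 3 := by omega
  rw [show 4 * a + 8 = (4 * a + 3) + 5 from rfl, ofNat]
  simp [h₁, h₂]

theorem OracleCode.ofNat_surjective : Function.Surjective ofNat := by
  intro c
  induction c with
  | zero => exact ⟨0, by rw [ofNat]⟩
  | succ => exact ⟨1, by rw [ofNat]⟩
  | left => exact ⟨2, by rw [ofNat]⟩
  | right => exact ⟨3, by rw [ofNat]⟩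
  | oracle => exact ⟨4, by rw [ofNat]⟩
  | pair c d ihc ihd =>
    obtain ⟨a, rfl⟩ := ihc
    obtain ⟨b, rfl⟩ := ihd
    exact ⟨_, ofNat_pair a b⟩
  | comp c d ihc ihd =>
    obtain ⟨a, rfl⟩ := ihc
    obtain ⟨b, rfl⟩ := ihd
    exact ⟨_, ofNat_comp a b⟩
  | prec c d ihc ihd =>
    obtain ⟨a, rfl⟩ := ihc
    obtain ⟨b, rfl⟩ := ihd
    exact ⟨_, ofNat_prec a b⟩
  | rfind c ihc =>
    obtain ⟨a, rfl⟩ := ihc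
    exact ⟨_, ofNat_rfind a⟩

/-- An index of the constant function with value `n`. -/
def constIndex : ℕ → ℕ
  | 0 => 0
  | n + 1 => 4 * Nat.pair 1 (constIndex n) + 6

theorem eval_constIndex (A : Set ℕ) (n x : ℕ) :
    (OracleCode.ofNat (constIndex n)).eval A x = Part.some n := by
  induction n with
  | zero => rw [constIndex, OracleCode.ofNat]; rfl
  | succ n ih =>
    rw [constIndex, OracleCode.ofNat_comp, OracleCode.ofNat]
    simp [OracleCode.eval, ih]

/-- The `s`-`m`-`n` function: from an index `e` of `φ`, an index of `x ↦ φ ⟨z, x⟩`. The inner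
numeral `4 * Nat.pair 2 3 + 5` is an index of the identity function. -/
def curryIndex (e z : ℕ) : ℕ :=
  4 * Nat.pair e (4 * Nat.pair (constIndex z) (4 * Nat.pair 2 3 + 5) + 5) + 6

theorem eval_curryIndex (A : Set ℕ) (e z x : ℕ) :
    (OracleCode.ofNat (curryIndex e z)).eval A x =
      (OracleCode.ofNat e).eval A (Nat.pair z x) := by
  rw [curryIndex, OracleCode.ofNat_comp, OracleCode.ofNat_pair, OracleCode.ofNat_pair]
  have h2 : OracleCode.ofNat 2 = .left := by rw [OracleCode.ofNat]
  have h3 : OracleCode.ofNat 3 = .right := by rw [OracleCode.ofNat]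
  refine OracleCode.eval_comp_of_eq_some ?_
  simp [OracleCode.eval, eval_constIndex, Seq.seq, h2, h3]

theorem mem_W_curryIndex {A : Set ℕ} {e z x : ℕ} :
    x ∈ W (curryIndex e z) A ↔ Nat.pair z x ∈ W e A := by
  simp [W, eval_curryIndex]

theorem computable_constIndex : Computable constIndex := by
  have hs : Primrec₂ fun (_ : ℕ) (p : ℕ × ℕ) => 4 * Nat.pair 1 p.2 + 6 :=
    (Primrec.nat_add.comp (Primrec.nat_mul.comp (Primrec.const 4)
      (Primrec₂.natPair.comp (Primrec.const 1) (Primrec.snd.comp Primrec.snd)))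
      (Primrec.const 6)).to₂
  refine ((Primrec.nat_rec' Primrec.id (Primrec.const 0) hs).of_eq fun n => ?_).to_comp
  induction n with
  | zero => rfl
  | succ n ih => simp only [constIndex, ← ih]; rfl

theorem computable_curryIndex : Computable₂ curryIndex := by
  have hp {f g : ℕ × ℕ → ℕ} (m : ℕ) (hf : Computable f) (hg : Computable g) :
      Computable fun p => 4 * Nat.pair (f p) (g p) + m :=
    Primrec.nat_add.to_comp.comp (Primrec.nat_mul.to_comp.comp (Computable.const 4)
      (Primrec₂.natPair.to_comp.comp hf hg)) (Computable.const m)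
  exact hp 6 Computable.fst
    (hp 5 (computable_constIndex.comp Computable.snd) (Computable.const _))

/-! ### Predicates that are r.e. in an oracle -/

/-- The predicate `p` is r.e. in `A`, expressed by a normal form: `p x` asserts the existence of
a zero of a total `A`-computable function. Closure under disjunction then needs no simulation of
oracle programs. -/
def REIn (A : Set ℕ) (p : ℕ → Prop) : Prop :=
  ∃ f : ℕ → ℕ, RecIn A f ∧ ∀ x, p x ↔ ∃ n, f (Nat.pair x n) = 0

theorem REIn.exists_index {A : Set ℕ} {p : ℕ → Prop} (hp : REIn A p) :
    ∃ e, ∀ x, x ∈ W e A ↔ p x := by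
  obtain ⟨f, ⟨c, hc⟩, hf⟩ := hp
  obtain ⟨e, he⟩ := OracleCode.ofNat_surjective (.rfind c)
  refine ⟨e, fun x => ?_⟩
  simp only [W, he, OracleCode.eval, hc, hf, Set.mem_ofPred_eq, Part.map_eq_map, Part.map_some]
  exact Nat.rfind_dom.trans (by simp)

theorem REIn.comp {A : Set ℕ} {p : ℕ → Prop} (hp : REIn A p) {g : ℕ → ℕ} (hg : Computable g) :
    REIn A fun x => p (g x) := by
  obtain ⟨f, hfA, hf⟩ := hp
  have hu := Computable.unpair
  refine ⟨fun m => f (Nat.pair (g m.unpair.1) m.unpair.2),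
    hfA.comp (RecIn.of_computable (Primrec₂.natPair.to_comp.comp
      (hg.comp (Computable.fst.comp hu)) (Computable.snd.comp hu))), fun x => ?_⟩
  simp [hf]

theorem REIn.of_iff {A : Set ℕ} {p q : ℕ → Prop} (hp : REIn A p) (h : ∀ x, q x ↔ p x) :
    REIn A q := by
  rwa [show q = p from funext fun x => propext (h x)]

theorem REIn.or {A : Set ℕ} {p q : ℕ → Prop} (hp : REIn A p) (hq : REIn A q) :
    REIn A fun x => p x ∨ q x := by
  obtain ⟨f, hfA, hf⟩ := hp
  obtain ⟨g, hgA, hg⟩ := hq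
  refine ⟨fun m => f m * g m, RecIn.comp₂ Primrec.nat_mul.to_comp hfA hgA, fun x => ?_⟩
  simp [hf, hg, exists_or]

theorem REIn.computable_and {A : Set ℕ} {p : ℕ → Prop} (hp : REIn A p) {t : ℕ → Bool}
    (ht : Computable t) : REIn A fun x => t x = true ∧ p x := by
  obtain ⟨f, hfA, hf⟩ := hp
  have hF : Computable₂ fun m n : ℕ => cond (t m.unpair.1) n 1 :=
    Computable.cond (ht.comp (Computable.fst.comp (Computable.unpair.comp Computable.fst)))
      Computable.snd (Computable.const 1)
  refine ⟨fun m => cond (t m.unpair.1) (f m) 1,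
    RecIn.comp₂ hF (RecIn.of_computable Computable.id) hfA, fun x => ?_⟩
  cases h : t x <;> simp [hf, h]

theorem REIn.exists {A : Set ℕ} {p : ℕ → Prop} (hp : REIn A p) :
    REIn A fun x => ∃ i, p (Nat.pair x i) := by
  obtain ⟨f, hfA, hf⟩ := hp
  have hu := Computable.unpair
  have h1 := Computable.fst.comp hu
  have h2 := Computable.snd.comp hu
  have hpr := Primrec₂.natPair.to_comp
  refine ⟨fun m => f (Nat.pair (Nat.pair m.unpair.1 m.unpair.2.unpair.1) m.unpair.2.unpair.2),
    hfA.comp (RecIn.of_computable (hpr.comp (hpr.comp h1 (h1.comp h2)) (h2.comp h2))),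
    fun x => ?_⟩
  simp only [hf, Nat.unpair_pair]
  constructor
  · rintro ⟨i, n, h⟩
    exact ⟨Nat.pair i n, by simpa using h⟩
  · rintro ⟨n, h⟩
    exact ⟨_, _, h⟩

theorem REIn.of_not_mem {A Y : Set ℕ} {f : ℕ → ℕ} (hf : RecIn A f)
    (hY : ∀ y, f y = 0 ↔ y ∉ Y) : REIn A fun x => ∃ n, Nat.pair x n ∉ Y :=
  ⟨f, hf, fun x => by simp [hY]⟩

/-- A set that is r.e. in `A` many-one reduces to the jump of `A`, hence is decidable in it. -/
theorem REIn.recIn_jump {A : Set ℕ} {p : ℕ → Prop} (hp : REIn A p) :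
    ∃ f, RecIn (jump A) f ∧ ∀ y, f y = 0 ↔ ¬ p y := by
  classical
  obtain ⟨e, he⟩ := (hp.comp (Computable.fst.comp Computable.unpair)).exists_index
  have hc : RecIn (jump A) (curryIndex e) :=
    RecIn.of_computable (computable_curryIndex.comp (Computable.const e) Computable.id)
  have ho : RecIn (jump A) fun n => if n ∈ jump A then 1 else 0 :=
    ⟨.oracle, fun n => by simp [OracleCode.eval, charFn]⟩
  refine ⟨_, ho.comp hc, fun y => ?_⟩
  simp [jump, mem_W_curryIndex, he]

/-- The half of Post's theorem that is needed: `Σ⁰_{j+1}` sets are r.e. in the `j`-th jump. -/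
theorem IsSigma.reIn {j : ℕ} {X : Set ℕ} (hX : IsSigma (j + 1) X) :
    REIn (emptyJump j) fun x => x ∈ X := by
  classical
  induction j generalizing X with
  | zero =>
    obtain ⟨Y, hY, hXY⟩ := hX
    obtain ⟨hd, hY⟩ := hY
    refine REIn.of_iff (REIn.of_not_mem (Y := Y) (f := fun y => cond (decide (y ∈ Y)) 1 0)
      (RecIn.of_computable (Computable.cond ?_ (Computable.const 1) (Computable.const 0)))
      fun y => ?_) hXY
    · convert hY
    · by_cases h : y ∈ Y <;> simp [h]
  | succ j ih =>
    obtain ⟨Y, hY, hXY⟩ := hX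
    obtain ⟨f, hf, hfY⟩ := (ih hY).recIn_jump
    exact REIn.of_iff (REIn.of_not_mem hf hfY) hXY


/-! ### Separation below an element -/

/-- Effective inseparability, uniformly below every nonzero element. Given disjoint r.e. events
`V t` and `U t` and a name `β t`, one computes a name `h t` whose trace on `β t` is `⊥` exactly
if `U t` holds, and all of `β t` exactly if `V t` holds.

The sets `{x | x ⊓ b = ⊥}` and `{x | b ≤ x}` contain the names of `⊥` and `⊤` and are disjoint if
`b ≠ ⊥`, so the productive function `g` applies to all their disjoint r.e. supersets. By
self-reference, let `p` and `q` be indices of `{x | x ⊓ b = ⊥} ∪ {c | V}` and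
`{x | b ≤ x} ∪ {c | U}`, where `c = g p q`: a trace of `c` on `b` that contradicts `U` or `V` would
leave these sets disjoint with `c` in one of them. -/
theorem Presentation.exists_separating {j : ℕ} {B : Type*} [BooleanAlgebra B]
    (𝓑 : Presentation (j + 1) B) (h𝓑 : 𝓑.IsEffectivelyInseparable) {β : ℕ → ℕ}
    (hβ : Computable β) {U V : ℕ → Prop} (hU : REIn (emptyJump j) U)
    (hV : REIn (emptyJump j) V) :
    ∃ h : ℕ → ℕ, Computable h ∧ ∀ t, 𝓑.val (β t) ≠ ⊥ → ¬ (U t ∧ V t) →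
      (𝓑.val (β t) ⊓ 𝓑.val (h t) = ⊥ ↔ U t) ∧ (𝓑.val (β t) ≤ 𝓑.val (h t) ↔ V t) := by
  obtain ⟨-, -, -, g, hg, hprod⟩ := h𝓑
  obtain ⟨z₀, hz₀⟩ := 𝓑.val_surjective ⊥
  simp only [Nat.add_sub_cancel] at hprod
  have hu := Computable.unpair
  have h1 := Computable.fst.comp hu
  have h2 := Computable.snd.comp hu
  have hpr := Primrec₂.natPair.to_comp
  have hle : REIn (emptyJump j) fun w => 𝓑.val w.unpair.1 ≤ 𝓑.val w.unpair.2 :=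
    (IsSigma.reIn 𝓑.sigma_le.2.2).of_iff fun w => by simp [𝓑.le_iff]
  -- The first component of `w` is `⟨⟨e₁, e₂⟩, t⟩`, where `e₁` and `e₂` stand for the programs
  -- under construction; the second one is the number to be enumerated.
  let c : ℕ → ℕ := fun z => g (curryIndex z.unpair.1.unpair.1 z) (curryIndex z.unpair.1.unpair.2 z)
  have hc : Computable c :=
    hg.comp (computable_curryIndex.comp (h1.comp h1) Computable.id)
      (computable_curryIndex.comp (h2.comp h1) Computable.id)
  have hb : Computable fun w : ℕ => β w.unpair.1.unpair.2 := hβ.comp (h2.comp h1)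
  have heq : Computable fun w : ℕ => decide (w.unpair.2 = c w.unpair.1) :=
    (Primrec.eq (α := ℕ)).decide.to_comp.comp h2 (hc.comp h1)
  obtain ⟨e₁, he₁⟩ := ((hle.comp (hpr.comp (𝓑.computable_inf.comp hb h2)
    (Computable.const z₀))).or ((hV.comp (h2.comp h1)).computable_and heq)).exists_index
  obtain ⟨e₂, he₂⟩ := ((hle.comp (hpr.comp hb h2)).or
    ((hU.comp (h2.comp h1)).computable_and heq)).exists_index
  let z : ℕ → ℕ := fun t => Nat.pair (Nat.pair e₁ e₂) t
  refine ⟨fun t => c (z t), hc.comp (hpr.comp (Computable.const _) Computable.id), ?_⟩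
  intro t hbt hUV
  have hp := hprod (curryIndex e₁ (z t)) (curryIndex e₂ (z t))
  have hcz : g (curryIndex e₁ (z t)) (curryIndex e₂ (z t)) = c (z t) := by simp [c, z]
  have hW₁ : ∀ x, x ∈ W (curryIndex e₁ (z t)) (emptyJump j) ↔
      𝓑.val (β t) ⊓ 𝓑.val x = ⊥ ∨ x = c (z t) ∧ V t := fun x => by
    simp [mem_W_curryIndex, he₁, 𝓑.val_inf, hz₀, z]
  have hW₂ : ∀ x, x ∈ W (curryIndex e₂ (z t)) (emptyJump j) ↔
      𝓑.val (β t) ≤ 𝓑.val x ∨ x = c (z t) ∧ U t := fun x => by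
    simp [mem_W_curryIndex, he₂, z]
  have hdis : ∀ x, 𝓑.val (β t) ⊓ 𝓑.val x = ⊥ → ¬ 𝓑.val (β t) ≤ 𝓑.val x :=
    fun x h h' => hbt (by rwa [inf_eq_left.2 h'] at h)
  by_cases hd : Disjoint (W (curryIndex e₁ (z t)) (emptyJump j))
      (W (curryIndex e₂ (z t)) (emptyJump j))
  · have hnot := hp
      (fun x hx => (hW₁ x).2 (.inl (by
        have hx : 𝓑.val x = ⊥ := hx
        rw [hx, inf_bot_eq])))
      (fun x hx => (hW₂ x).2 (.inl (by
        have hx : 𝓑.val x = ⊤ := hx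
        rw [hx]
        exact le_top))) hd
    rw [hcz, Set.mem_union, hW₁, hW₂] at hnot
    simp only [true_and, not_or] at hnot
    exact ⟨iff_of_false hnot.1.1 hnot.2.2, iff_of_false hnot.2.1 hnot.1.2⟩
  · obtain ⟨x, hx₁, hx₂⟩ := Set.not_disjoint_iff.1 hd
    rw [hW₁] at hx₁
    rw [hW₂] at hx₂
    rcases hx₁ with hx₁ | ⟨rfl, hVt⟩
    · rcases hx₂ with hx₂ | ⟨rfl, hUt⟩
      · exact (hdis x hx₁ hx₂).elim
      · exact ⟨iff_of_true hx₁ hUt, iff_of_false (hdis _ hx₁) fun hVt => hUV ⟨hUt, hVt⟩⟩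
    · rcases hx₂ with hx₂ | ⟨-, hUt⟩
      · exact ⟨iff_of_false (fun h => hdis _ h hx₂) fun hUt => hUV ⟨hUt, hVt⟩,
          iff_of_true hx₂ hVt⟩
      · exact (hUV ⟨hUt, hVt⟩).elim

/-! ### Minterms -/

section Minterms

variable {k : ℕ} {B : Type*} [BooleanAlgebra B] (𝓑 : Presentation k B) (h : ℕ → ℕ) (one : ℕ)

/-- The name of the minterm of the first `n` generators with sign pattern `s`: the `i`-th generator
occurs positively if the bit of index `i` of `s` is `1`, and complemented otherwise. Only the bits
of index below `n` matter. The new generator of stage `n` agrees on the minterm `b` of pattern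
`s < 2 ^ n` with the value of `h` at the code of `n`, `s`, `b`. -/
def minterm (s : ℕ) : ℕ → ℕ
  | 0 => one
  | n + 1 =>
    let b := minterm s n
    let c := h (Nat.pair (Nat.pair n (s % 2 ^ n)) b)
    𝓑.inf b (bif s.testBit n then c else 𝓑.compl c)

/-- The name of the `n`-th generator: the join, over all sign patterns `s` of length `n`, of the
minterms of length `n + 1` that extend `s` positively. -/
def generator (n : ℕ) : ℕ :=
  Nat.rec (𝓑.compl one) (fun s x => 𝓑.sup x (minterm 𝓑 h one (2 ^ n + s) (n + 1))) (2 ^ n)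

theorem minterm_congr {s t n : ℕ} (hst : ∀ i < n, s.testBit i = t.testBit i) :
    minterm 𝓑 h one s n = minterm 𝓑 h one t n := by
  induction n with
  | zero => rfl
  | succ n ih =>
    have hmod : s % 2 ^ n = t % 2 ^ n := Nat.eq_of_testBit_eq fun i => by
      by_cases hi : i < n
      · simp [hi, hst i (by omega)]
      · simp [hi]
    simp only [minterm]
    rw [ih fun i hi => hst i (by omega), hmod, hst n (by omega)]

theorem minterm_mod (s n : ℕ) : minterm 𝓑 h one (s % 2 ^ n) n = minterm 𝓑 h one s n :=
  minterm_congr 𝓑 h one fun i hi => by simp [hi]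

variable {𝓑 h one}

theorem val_minterm_le {s m n : ℕ} (hmn : m ≤ n) :
    𝓑.val (minterm 𝓑 h one s n) ≤ 𝓑.val (minterm 𝓑 h one s m) := by
  induction n, hmn using Nat.le_induction with
  | base => exact le_rfl
  | succ n _ ih =>
    simp only [minterm, 𝓑.val_inf]
    exact inf_le_left.trans ih

theorem val_minterm_inf {s t n i : ℕ} (hi : i < n) (hs : s.testBit i ≠ t.testBit i) :
    𝓑.val (minterm 𝓑 h one s n) ⊓ 𝓑.val (minterm 𝓑 h one t n) = ⊥ := by
  induction n generalizing i with
  | zero => omega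
  | succ n ih =>
    by_cases hd : ∃ i < n, s.testBit i ≠ t.testBit i
    · obtain ⟨m, hm, hsm⟩ := hd
      exact le_bot_iff.1 ((inf_le_inf (val_minterm_le n.le_succ) (val_minterm_le n.le_succ)).trans
        (ih hm hsm).le)
    · push Not at hd
      have hin : i = n := by
        by_contra hne
        exact hs (hd i (by omega))
      subst hin
      have hmod : s % 2 ^ i = t % 2 ^ i := Nat.eq_of_testBit_eq fun m => by
        by_cases hm : m < i
        · simp [hm, hd m hm]
        · simp [hm]
      simp only [minterm, minterm_congr 𝓑 h one hd, hmod, 𝓑.val_inf]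
      rw [← le_bot_iff]
      refine (inf_le_inf inf_le_right inf_le_right).trans ?_
      cases hsi : s.testBit i <;> cases hti : t.testBit i <;>
        simp_all [𝓑.val_compl]

theorem val_generator (hone : 𝓑.val one = ⊤) (n : ℕ) :
    𝓑.val (generator 𝓑 h one n) =
      (Finset.range (2 ^ n)).sup fun s => 𝓑.val (minterm 𝓑 h one (2 ^ n + s) (n + 1)) := by
  rw [generator]
  generalize 2 ^ n = N at *
  suffices H : ∀ M : ℕ, 𝓑.val (Nat.rec (𝓑.compl one)
      (fun s x => 𝓑.sup x (minterm 𝓑 h one (N + s) (n + 1))) M) =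
      (Finset.range M).sup fun s => 𝓑.val (minterm 𝓑 h one (N + s) (n + 1)) from H N
  intro M
  induction M with
  | zero => simp [𝓑.val_compl, hone]
  | succ M ih => rw [Finset.range_add_one, Finset.sup_insert, sup_comm, ← ih, ← 𝓑.val_sup]

theorem val_minterm_le_generator (hone : 𝓑.val one = ⊤) {s i n : ℕ} (hi : i < n)
    (hs : s.testBit i = true) :
    𝓑.val (minterm 𝓑 h one s n) ≤ 𝓑.val (generator 𝓑 h one i) := by
  rw [val_generator hone]
  refine (val_minterm_le (Nat.succ_le_of_lt hi)).trans ?_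
  have hc : minterm 𝓑 h one s (i + 1) = minterm 𝓑 h one (2 ^ i + s % 2 ^ i) (i + 1) := by
    refine minterm_congr 𝓑 h one fun m hm => ?_
    rcases Nat.lt_succ_iff_lt_or_eq.1 hm with hm | rfl
    · rw [Nat.testBit_two_pow_add_gt hm]
      simp [hm]
    · simp [Nat.testBit_two_pow_add_eq, hs]
  rw [Nat.succ_eq_add_one, hc]
  exact Finset.le_sup (f := fun r => 𝓑.val (minterm 𝓑 h one (2 ^ i + r) (i + 1)))
    (Finset.mem_range.2 (Nat.mod_lt _ (by positivity)))

theorem val_minterm_inf_generator (hone : 𝓑.val one = ⊤) {s i n : ℕ} (hi : i < n)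
    (hs : s.testBit i = false) :
    𝓑.val (minterm 𝓑 h one s n) ⊓ 𝓑.val (generator 𝓑 h one i) = ⊥ := by
  rw [val_generator hone, ← disjoint_iff, Finset.disjoint_sup_right]
  intro r hr
  refine Disjoint.mono_left (val_minterm_le (Nat.succ_le_of_lt hi)) (disjoint_iff.2
    (val_minterm_inf (Nat.lt_succ_self i) ?_))
  rw [Nat.testBit_two_pow_add_eq, hs, Nat.testBit_eq_false_of_lt (Finset.mem_range.1 hr)]
  simp

/-- The minterms of length `n` have join `⊤`. -/
theorem le_of_forall_minterm (hone : 𝓑.val one = ⊤) (n : ℕ) {x y : B}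
    (H : ∀ s, x ⊓ 𝓑.val (minterm 𝓑 h one s n) ≤ y) : x ≤ y := by
  induction n with
  | zero => simpa [minterm, hone] using H 0
  | succ n ih =>
    refine ih fun s => ?_
    -- The two extensions of the pattern `s` by one sign.
    have ht := H (2 ^ n + s % 2 ^ n)
    have hf := H (s % 2 ^ n)
    have hlt : s % 2 ^ n < 2 ^ n := Nat.mod_lt _ (by positivity)
    have hc : minterm 𝓑 h one (2 ^ n + s % 2 ^ n) n = minterm 𝓑 h one s n :=
      minterm_congr 𝓑 h one fun m hm => by rw [Nat.testBit_two_pow_add_gt hm]; simp [hm]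
    simp only [minterm, hc, minterm_mod, Nat.testBit_two_pow_add_eq, Nat.mod_mod,
      Nat.add_mod_left, Nat.testBit_eq_false_of_lt hlt, Bool.not_false, cond_true, cond_false,
      𝓑.val_inf, 𝓑.val_compl, ← inf_assoc] at ht hf
    rw [← sup_inf_inf_compl (x := x ⊓ 𝓑.val (minterm 𝓑 h one s n))]
    exact sup_le ht hf

end Minterms


/-! ### Computability of the generators -/

theorem computable_two_pow : Computable fun n : ℕ => 2 ^ n := by
  refine (Computable.nat_rec Computable.id (Computable.const 1)
    (h := fun _ p => 2 * p.2) (Primrec.nat_mul.to_comp.comp (Computable.const 2)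
      (Computable.snd.comp Computable.snd)).to₂).of_eq fun n => ?_
  induction n with
  | zero => rfl
  | succ n ih => rw [pow_succ', ← ih]; rfl

theorem computable_testBit : Computable₂ Nat.testBit := by
  have h := (Primrec.eq (α := ℕ)).decide.to_comp.comp
    (Primrec.nat_mod.to_comp.comp (Primrec.nat_div.to_comp.comp Computable.fst
      (computable_two_pow.comp Computable.snd)) (Computable.const 2)) (Computable.const 1)
  exact h.of_eq fun p => Nat.testBit_eq_decide_div_mod_eq.symm

theorem computable_minterm {k : ℕ} {B : Type*} [BooleanAlgebra B] (𝓑 : Presentation k B)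
    {h : ℕ → ℕ} (hh : Computable h) (one : ℕ) : Computable₂ (minterm 𝓑 h one) := by
  have hpr := Primrec₂.natPair.to_comp
  -- The arguments are the pair `⟨s, n⟩` on the left, and the stage and the value there on the right.
  have hs : Computable fun w : (ℕ × ℕ) × (ℕ × ℕ) => w.1.1 := Computable.fst.comp Computable.fst
  have hm : Computable fun w : (ℕ × ℕ) × (ℕ × ℕ) => w.2.1 := Computable.fst.comp Computable.snd
  have hb : Computable fun w : (ℕ × ℕ) × (ℕ × ℕ) => w.2.2 := Computable.snd.comp Computable.snd
  have hc := hh.comp (hpr.comp (hpr.comp hm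
    (Primrec.nat_mod.to_comp.comp hs (computable_two_pow.comp hm))) hb)
  refine (Computable.nat_rec (Computable.snd (α := ℕ) (β := ℕ)) (Computable.const one)
    (𝓑.computable_inf.comp hb (Computable.cond (computable_testBit.comp hs hm) hc
      (𝓑.computable_compl.comp hc))).to₂).of_eq fun p => ?_
  obtain ⟨s, n⟩ := p
  induction n with
  | zero => rfl
  | succ n ih =>
    simp only [minterm] at ih ⊢
    rw [← ih]

theorem computable_generator {k : ℕ} {B : Type*} [BooleanAlgebra B] (𝓑 : Presentation k B)
    {h : ℕ → ℕ} (hh : Computable h) (one : ℕ) : Computable (generator 𝓑 h one) := by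
  have hn : Computable fun w : ℕ × (ℕ × ℕ) => w.1 := Computable.fst
  exact Computable.nat_rec computable_two_pow (Computable.const _)
    (𝓑.computable_sup.comp (Computable.snd.comp Computable.snd)
      ((computable_minterm 𝓑 hh one).comp
        (Primrec.nat_add.to_comp.comp (computable_two_pow.comp hn)
          (Computable.fst.comp Computable.snd)) (Computable.succ.comp hn))).to₂

/-! ### Completeness -/

/-- A minterm is `⊥` exactly if its sign pattern is inconsistent with the preorder `P`, provided `h`
decides each nonzero minterm as the relations `P` between the new index and the old ones demand. -/
theorem val_minterm_eq_bot_iff {k : ℕ} {B : Type*} [BooleanAlgebra B] [Nontrivial B]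
    {𝓑 : Presentation k B} {h : ℕ → ℕ} {one : ℕ} (hone : 𝓑.val one = ⊤) {P : ℕ → ℕ → Prop}
    (htrans : ∀ x y z, P x y → P y z → P x z)
    (hh : ∀ n s b, 𝓑.val b ≠ ⊥ →
      ¬ ((∃ i < n, s.testBit i = false ∧ P n i) ∧ ∃ i < n, s.testBit i = true ∧ P i n) →
      (𝓑.val b ⊓ 𝓑.val (h (Nat.pair (Nat.pair n s) b)) = ⊥ ↔
        ∃ i < n, s.testBit i = false ∧ P n i) ∧
      (𝓑.val b ≤ 𝓑.val (h (Nat.pair (Nat.pair n s) b)) ↔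
        ∃ i < n, s.testBit i = true ∧ P i n))
    (s n : ℕ) :
    𝓑.val (minterm 𝓑 h one s n) = ⊥ ↔
      ∃ i < n, ∃ l < n, s.testBit i = true ∧ s.testBit l = false ∧ P i l := by
  induction n with
  | zero => simp [minterm, hone]
  | succ n ih =>
    by_cases hbot : 𝓑.val (minterm 𝓑 h one s n) = ⊥
    · obtain ⟨i, hi, l, hl, hil⟩ := ih.1 hbot
      exact iff_of_true (le_bot_iff.1 ((val_minterm_le n.le_succ).trans hbot.le))
        ⟨i, by omega, l, by omega, hil⟩
    · have hcons := fun hex => hbot (ih.2 hex)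
      have hmod : ∀ i < n, (s % 2 ^ n).testBit i = s.testBit i := fun i hi => by simp [hi]
      obtain ⟨hU, hV⟩ := hh n (s % 2 ^ n) _ hbot (by
        rintro ⟨⟨l, hl, hsl, hnl⟩, i, hi, hsi, hin⟩
        rw [hmod _ hl] at hsl
        rw [hmod _ hi] at hsi
        exact hcons ⟨i, hi, l, hl, hsi, hsl, htrans _ _ _ hin hnl⟩)
      cases hn : s.testBit n
      · simp only [minterm, hn, cond_false, 𝓑.val_inf, 𝓑.val_compl]
        rw [← disjoint_iff, disjoint_compl_right_iff, hV]
        constructor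
        · rintro ⟨i, hi, hsi, hin⟩
          exact ⟨i, by omega, n, by omega, by rwa [hmod _ hi] at hsi, hn, hin⟩
        · rintro ⟨i, hi, l, hl, hsi, hsl, hil⟩
          have hi' : i < n := by
            rcases Nat.lt_succ_iff_lt_or_eq.1 hi with h' | rfl
            · exact h'
            · simp [hn] at hsi
          rcases Nat.lt_succ_iff_lt_or_eq.1 hl with hl' | rfl
          · exact (hcons ⟨i, hi', l, hl', hsi, hsl, hil⟩).elim
          · exact ⟨i, hi', by rwa [hmod _ hi'], hil⟩
      · simp only [minterm, hn, cond_true, 𝓑.val_inf]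
        rw [hU]
        constructor
        · rintro ⟨l, hl, hsl, hnl⟩
          exact ⟨n, by omega, l, by omega, hn, by rwa [hmod _ hl] at hsl, hnl⟩
        · rintro ⟨i, hi, l, hl, hsi, hsl, hil⟩
          have hl' : l < n := by
            rcases Nat.lt_succ_iff_lt_or_eq.1 hl with h' | rfl
            · exact h'
            · simp [hn] at hsl
          rcases Nat.lt_succ_iff_lt_or_eq.1 hi with hi' | rfl
          · exact (hcons ⟨i, hi', l, hl', hsi, hsl, hil⟩).elim
          · exact ⟨l, hl', by rwa [hmod _ hl'], hil⟩

theorem exists_testBit_iff (p : ℕ → Prop) (n : ℕ) : ∃ s : ℕ, ∀ i < n, s.testBit i = true ↔ p i := by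
  classical
  refine ⟨Nat.ofBits (n := n) fun i => decide (p i), fun i hi => ?_⟩
  simp [Nat.testBit_ofBits_lt _ _ hi]

theorem generator_le_iff {k : ℕ} {B : Type*} [BooleanAlgebra B] {𝓑 : Presentation k B}
    {h : ℕ → ℕ} {one : ℕ} (hone : 𝓑.val one = ⊤) {P : ℕ → ℕ → Prop} (hrefl : ∀ x, P x x)
    (htrans : ∀ x y z, P x y → P y z → P x z)
    (hbot : ∀ s n, 𝓑.val (minterm 𝓑 h one s n) = ⊥ ↔
      ∃ i < n, ∃ l < n, s.testBit i = true ∧ s.testBit l = false ∧ P i l) (x y : ℕ) :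
    𝓑.val (generator 𝓑 h one x) ≤ 𝓑.val (generator 𝓑 h one y) ↔ P x y := by
  have hx : x < x + y + 1 := by omega
  have hy : y < x + y + 1 := by omega
  constructor
  · intro hle
    by_contra hP
    -- The up-set of `x` gives a consistent pattern that separates `x` from `y`.
    obtain ⟨s, hs⟩ := exists_testBit_iff (P x) (x + y + 1)
    have hsy : s.testBit y = false := by
      rw [← Bool.not_eq_true, hs y hy]
      exact hP
    have h1 := (val_minterm_le_generator (𝓑 := 𝓑) (h := h) hone hx ((hs x hx).2 (hrefl x))).trans hle
    have h2 := val_minterm_inf_generator (𝓑 := 𝓑) (h := h) hone hy hsy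
    rw [inf_eq_left.2 h1] at h2
    obtain ⟨i, hi, l, hl, hsi, hsl, hil⟩ := (hbot _ _).1 h2
    rw [← Bool.not_eq_true, hs l hl] at hsl
    exact hsl (htrans _ _ _ ((hs i hi).1 hsi) hil)
  · intro hP
    refine le_of_forall_minterm (h := h) hone (x + y + 1) fun s => ?_
    cases hsx : s.testBit x
    · rw [inf_comm, val_minterm_inf_generator hone hx hsx]
      exact bot_le
    · cases hsy : s.testBit y
      · rw [(hbot s _).2 ⟨x, hx, y, hy, hsx, hsy, hP⟩, inf_bot_eq]
        exact bot_le
      · exact inf_le_right.trans (val_minterm_le_generator hone hy hsy)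

theorem computable_bounded_testBit (v : Bool) : Computable fun w : ℕ =>
    decide (w.unpair.2 < w.unpair.1.unpair.1.unpair.1) &&
      (w.unpair.1.unpair.1.unpair.2.testBit w.unpair.2 == v) := by
  have h1 := Computable.fst.comp Computable.unpair
  have h2 := Computable.snd.comp Computable.unpair
  exact Primrec.and.to_comp.comp
    ((Primrec.nat_lt.decide.to_comp).comp h2 (h1.comp (h1.comp h1)))
    (Primrec.beq.to_comp.comp (computable_testBit.comp (h2.comp (h1.comp h1)) h2)
      (Computable.const v))

end SigmaBA

theorem theorem3p4 (k : ℕ) (hk : 1 ≤ k) {B : Type*} [BooleanAlgebra B]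
    (𝓑 : SigmaBA.Presentation k B) (h𝓑 : 𝓑.IsEffectivelyInseparable) :
    SigmaBA.IsSigmaCompletePreorder k 𝓑.le := by
  open SigmaBA in
  obtain ⟨j, rfl⟩ := Nat.exists_eq_add_of_le' hk
  refine ⟨𝓑.sigma_le, fun P hP => ?_⟩
  obtain ⟨hrefl, htrans, hsig⟩ := hP
  obtain ⟨one, hone⟩ := 𝓑.val_surjective ⊤
  have hnt : Nontrivial B := ⟨⊥, ⊤, fun hbt =>
    Set.disjoint_left.1 h𝓑.2.2.1 (show one ∈ {x | 𝓑.val x = ⊥} from hone.trans hbt.symm) hone⟩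
  have h1 := Computable.fst.comp Computable.unpair
  have h2 := Computable.snd.comp Computable.unpair
  have hpr := Primrec₂.natPair.to_comp
  have hn := h1.comp (h1.comp h1)
  have hP := IsSigma.reIn hsig
  obtain ⟨h, hcomp, hh⟩ := 𝓑.exists_separating h𝓑 h2
    ((hP.comp (hpr.comp hn h2)).computable_and (computable_bounded_testBit false)).exists
    ((hP.comp (hpr.comp h2 hn)).computable_and (computable_bounded_testBit true)).exists
  refine ⟨generator 𝓑 h one, computable_generator 𝓑 hcomp one, fun x y => ?_⟩
  rw [𝓑.le_iff]
  refine (generator_le_iff hone hrefl htrans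
    (val_minterm_eq_bot_iff hone htrans (fun n s b => ?_)) x y).symm
  simpa [and_assoc] using hh (Nat.pair (Nat.pair n s) b)
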